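/- \textbf{Theorem (General transfer-model feasibility).} Let $\theta\in(0,\pi/2)$ and let $|\psi(\theta)\rangle_{AB}=\cos\theta\,|00\rangle+\sin\theta\,|11\rangle$ be a pure state of two qubits, $A$ held by Alice and $B$ held by Bob. Let $A',B',K$ be finite-dimensional registers and let $|\Omega\rangle_{A'B'K}\in\mathbb{C}^{d_{A'}}\otimes\mathbb{C}^{d_{B'}}\otimes\mathbb{C}^{d_K}$ be an arbitrary unit vector (the Bank's resource), with $A'$ sent to Alice and $B'$ to Bob. In the transfer model the Bank hands the register $K$ to Alice and then takes no further part, so that Alice and Bob share the pure state $$|\Psi\rangle=|\psi(\theta)\rangle_{AB}\otimes|\Omega\rangle_{A'B'K},$$ with Alice holding $AA'K$ and Bob holding $BB'$. Say that \emph{deterministic Bell-pair restoration on $AB$ is possible by LOCC} if there are finite-dimensional leftover registers $J$ (with Alice) and $L$ (with Bob), a density operator $\sigma$ on $JL$, and a protocol $\Lambda$ of local operations and classical communication between Alice and Bob (finitely many rounds; in each round one party applies to its share a quantum instrument with finitely many outcomes, which may add or discard local systems, and announces the outcome, on which all later steps may depend) such that $$\Lambda\bigl(|\Psi\rangle\langle\Psi|\bigr)=|\Phi^+\rangle\langle\Phi^+|_{AB}\otimes\sigma_{JL},\qquad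 |\Phi^+\rangle=\tfrac{1}{\sqrt2}\bigl(|00\rangle+|11\rangle\bigr).$$ Then deterministic Bell-pair restoration on $AB$ is possible by LOCC if and only if the largest squared Schmidt coefficient of $|\Psi\rangle$ across the bipartition $AA'K\mid BB'$ is at most $1/2$. -/

import Mathlib

open scoped Kronecker ComplexOrder

noncomputable section

/-- The density operator `|Ψ⟩⟨Ψ|` of a state vector `Ψ`. -/
def pureDensity {I : Type} (Ψ : EuclideanSpace ℂ I) : Matrix I I ℂ :=
  Matrix.of fun x y => Ψ x * star (Ψ y)

/-- A density operator: positive semidefinite with unit trace. -/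
def IsDensity {I : Type} [Fintype I] (σ : Matrix I I ℂ) : Prop :=
  σ.PosSemidef ∧ σ.trace = 1

/-- The imperfect link `|ψ(θ)⟩ = cos θ |00⟩ + sin θ |11⟩` on the qubits `A`, `B`. -/
def linkState (θ : ℝ) : EuclideanSpace ℂ (Fin 2 × Fin 2) :=
  WithLp.toLp 2 fun p =>
    if p = (0, 0) then (Real.cos θ : ℂ) else if p = (1, 1) then (Real.sin θ : ℂ) else 0

/-- The Bell pair `|Φ⁺⟩ = (|00⟩ + |11⟩) / √2`. -/
def bellState : EuclideanSpace ℂ (Fin 2 × Fin 2) :=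
  WithLp.toLp 2 fun p => if p.1 = p.2 then ((1 / Real.sqrt 2 : ℝ) : ℂ) else 0

/-- The initial state of the transfer model, `|ψ(θ)⟩_{AB} ⊗ |Ω⟩_{A'B'K}`, with its registers
regrouped according to who holds them after `K` was moved to Alice: `AA'K` with Alice and
`BB'` with Bob. -/
def transferState {A' B' K : Type} (θ : ℝ) (Ω : EuclideanSpace ℂ (A' × B' × K)) :
    EuclideanSpace ℂ ((Fin 2 × A' × K) × (Fin 2 × B')) :=
  WithLp.toLp 2 fun p =>
    linkState θ (p.1.1, p.2.1) * Ω (p.1.2.1, p.2.2, p.1.2.2)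

/-- The Schmidt coefficients, in non-increasing order and padded with zeros, of a bipartite
state vector: the singular values of its coefficient matrix `(a, b) ↦ Ψ (a, b)`. -/
def schmidtCoeff {A B : Type} [Fintype A] [Fintype B] [DecidableEq B]
    (Ψ : EuclideanSpace ℂ (A × B)) : ℕ →₀ ℝ :=
  (Matrix.toEuclideanLin (Matrix.of fun (a : A) (b : B) => Ψ (a, b))).singularValues

/-- The largest squared Schmidt coefficient of a bipartite state vector. -/
def maxSqSchmidt {A B : Type} [Fintype A] [Fintype B] [DecidableEq B]
    (Ψ : EuclideanSpace ℂ (A × B)) : ℝ :=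
  schmidtCoeff Ψ 0 ^ 2

/-- A quantum instrument on the space `ℂ^A` with outcomes `i : Fin n`. The outcome `i` is the
completely positive map from operators on `ℂ^A` to operators on `ℂ^(C i)` that has the Kraus
operators `M i k`, `k : Fin (r i)`; the sum of these maps over `i` is trace preserving. The output
register may depend on the outcome, so that adding and discarding local systems is included. -/
structure Instrument (A : Type) [Fintype A] [DecidableEq A] {n : ℕ} (C : Fin n → Type)
    [∀ i, Fintype (C i)] where
  /-- The number of Kraus operators of each outcome. -/
  r : Fin n → ℕ
  /-- The Kraus operators. -/
  M : ∀ i, Fin (r i) → Matrix (C i) A ℂ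
  complete : ∑ i, ∑ k, (M i k).conjTranspose * M i k = 1

/-- The unnormalized state after Alice applied `𝓘` and found the outcome `i`. -/
def Instrument.onAlice {A B : Type} [Fintype A] [DecidableEq A] [Fintype B] [DecidableEq B]
    {n : ℕ} {C : Fin n → Type} [∀ i, Fintype (C i)] (𝓘 : Instrument A C) (i : Fin n)
    (ρ : Matrix (A × B) (A × B) ℂ) : Matrix (C i × B) (C i × B) ℂ :=
  ∑ k, (𝓘.M i k ⊗ₖ (1 : Matrix B B ℂ)) * ρ * (𝓘.M i k ⊗ₖ (1 : Matrix B B ℂ)).conjTranspose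

/-- The unnormalized state after Bob applied `𝓘` and found the outcome `i`. -/
def Instrument.onBob {A B : Type} [Fintype A] [DecidableEq A] [Fintype B] [DecidableEq B]
    {n : ℕ} {C : Fin n → Type} [∀ i, Fintype (C i)] (𝓘 : Instrument B C) (i : Fin n)
    (ρ : Matrix (A × B) (A × B) ℂ) : Matrix (A × C i) (A × C i) ℂ :=
  ∑ k, ((1 : Matrix A A ℂ) ⊗ₖ 𝓘.M i k) * ρ * ((1 : Matrix A A ℂ) ⊗ₖ 𝓘.M i k).conjTranspose

/-- `IsLOCC Λ`: the map `Λ` from operators on `A ⊗ B` to operators on `A₁ ⊗ B₁` is implemented by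
local operations and finitely many rounds of two-way classical communication. Either nothing is
done, or one party applies an instrument to its share and announces the outcome, and then an LOCC
protocol chosen according to the outcome is run. -/
inductive IsLOCC {A₁ B₁ : Type} : ∀ {A B : Type},
    (Matrix (A × B) (A × B) ℂ → Matrix (A₁ × B₁) (A₁ × B₁) ℂ) → Prop
  | done : IsLOCC (A := A₁) (B := B₁) fun ρ => ρ
  | alice {A B : Type} [Fintype A] [DecidableEq A] [Fintype B] [DecidableEq B]
      {n : ℕ} {C : Fin n → Type} [∀ i, Fintype (C i)] (𝓘 : Instrument A C)
      (Λ : ∀ i, Matrix (C i × B) (C i × B) ℂ → Matrix (A₁ × B₁) (A₁ × B₁) ℂ)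
      (hΛ : ∀ i, IsLOCC (Λ i)) :
      IsLOCC fun ρ : Matrix (A × B) (A × B) ℂ => ∑ i, Λ i (𝓘.onAlice i ρ)
  | bob {A B : Type} [Fintype A] [DecidableEq A] [Fintype B] [DecidableEq B]
      {n : ℕ} {C : Fin n → Type} [∀ i, Fintype (C i)] (𝓘 : Instrument B C)
      (Λ : ∀ i, Matrix (A × C i) (A × C i) ℂ → Matrix (A₁ × B₁) (A₁ × B₁) ℂ)
      (hΛ : ∀ i, IsLOCC (Λ i)) :
      IsLOCC fun ρ : Matrix (A × B) (A × B) ℂ => ∑ i, Λ i (𝓘.onBob i ρ)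

/-- The operator `τ_{AB} ⊗ σ_{JL}`, with the registers grouped as `AJ | BL`. -/
def bipartiteTensor {J L : Type} (τ : Matrix (Fin 2 × Fin 2) (Fin 2 × Fin 2) ℂ)
    (σ : Matrix (J × L) (J × L) ℂ) :
    Matrix ((Fin 2 × J) × (Fin 2 × L)) ((Fin 2 × J) × (Fin 2 × L)) ℂ :=
  Matrix.of fun p q =>
    τ (p.1.1, p.2.1) (q.1.1, q.2.1) * σ (p.1.2, p.2.2) (q.1.2, q.2.2)

/-- Deterministic restoration of a Bell pair on the qubits `AB` by LOCC from the bipartite pure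
state `Ψ`: some LOCC protocol ends with certainty in `|Φ⁺⟩⟨Φ⁺|_{AB} ⊗ σ`, where `σ` is some state
of leftover registers `J` (with Alice) and `L` (with Bob). -/
def CanRestoreBellPair {A B : Type} (Ψ : EuclideanSpace ℂ (A × B)) : Prop :=
  ∃ (J L : Type) (_ : Fintype J) (_ : Fintype L)
    (Λ : Matrix (A × B) (A × B) ℂ →
      Matrix ((Fin 2 × J) × (Fin 2 × L)) ((Fin 2 × J) × (Fin 2 × L)) ℂ)
    (σ : Matrix (J × L) (J × L) ℂ),
    IsLOCC Λ ∧ IsDensity σ ∧ Λ (pureDensity Ψ) = bipartiteTensor (pureDensity bellState) σ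

end

/-! A bipartite vector is handled through its coefficient matrix `X`: a Kraus operator of Alice
multiplies `X` on the left, one of Bob multiplies it by a transpose on the right, and the largest
squared Schmidt coefficient is the top eigenvalue of `Xᴴ * X`.

Necessity: completeness of an instrument, the C*-identity and the triangle inequality show that the
sum of squared operator norms over all branches cannot decrease
(`IsLOCC.exists_pure_decomposition`). If the final mixture is `Φ⁺ ⊗ σ`, every branch is of the form
`1 ⊗ χ`, whose squared operator norm is at most half its squared Hilbert-Schmidt norm; the latter
sum to the trace, which is 1 (`sum_sq_l2_opNorm_le_half`).

Sufficiency: if no eigenvalue `d b` exceeds half the total, `d` is the degree sequence of a loopless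
weighted graph (`exists_symmetric_weights`). Alice measures which edge `{i, j}` occurs; this leaves
a maximally entangled state on the Schmidt vectors `i`, `j`, which Bob rotates to a Bell pair
(`exists_isLOCC_to_bell`). -/

open Matrix

/-! ### Local operations on coefficient matrices -/

/-- The matrix of coefficients of a bipartite vector. -/
def coeffMatrix {A B : Type} (Ψ : EuclideanSpace ℂ (A × B)) : Matrix A B ℂ :=
  Matrix.of fun a b => Ψ (a, b)

/-- The unnormalized density operator of the bipartite vector with coefficient matrix `X`. -/
def pureOfCoeff {A B : Type} (X : Matrix A B ℂ) : Matrix (A × B) (A × B) ℂ :=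
  Matrix.of fun p q => X p.1 p.2 * star (X q.1 q.2)

theorem pureDensity_eq_pureOfCoeff {A B : Type} (Ψ : EuclideanSpace ℂ (A × B)) :
    pureDensity Ψ = pureOfCoeff (coeffMatrix Ψ) := rfl

@[simp]
theorem pureOfCoeff_zero {A B : Type} : pureOfCoeff (0 : Matrix A B ℂ) = 0 := by
  ext; simp [pureOfCoeff]

theorem pureOfCoeff_real_smul {A B : Type} (c : ℝ) (X : Matrix A B ℂ) :
    pureOfCoeff ((c : ℂ) • X) = ((c ^ 2 : ℝ) : ℂ) • pureOfCoeff X := by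
  ext p q
  simp [pureOfCoeff]
  ring

theorem pureOfCoeff_eq_vecMulVec {A B : Type} (X : Matrix A B ℂ) :
    pureOfCoeff X = vecMulVec (fun p : A × B => X p.1 p.2) (star fun p : A × B => X p.1 p.2) := by
  ext p q
  simp [pureOfCoeff, vecMulVec_apply]

theorem kronecker_one_mul_pureOfCoeff {A B C : Type} [Fintype A] [Fintype B] [DecidableEq B]
    (M : Matrix C A ℂ) (X : Matrix A B ℂ) :
    (M ⊗ₖ (1 : Matrix B B ℂ)) * pureOfCoeff X * (M ⊗ₖ (1 : Matrix B B ℂ))ᴴ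
      = pureOfCoeff (M * X) := by
  have h : (M ⊗ₖ (1 : Matrix B B ℂ)) *ᵥ (fun p : A × B => X p.1 p.2)
      = fun p : C × B => (M * X) p.1 p.2 := by
    ext p
    simp [mulVec, dotProduct, Fintype.sum_prod_type, Matrix.mul_apply, Matrix.one_apply]
  rw [pureOfCoeff_eq_vecMulVec, pureOfCoeff_eq_vecMulVec, mul_vecMulVec, vecMulVec_mul,
    ← star_mulVec, h]

theorem one_kronecker_mul_pureOfCoeff {A B C : Type} [Fintype A] [DecidableEq A] [Fintype B]
    (N : Matrix C B ℂ) (X : Matrix A B ℂ) :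
    ((1 : Matrix A A ℂ) ⊗ₖ N) * pureOfCoeff X * ((1 : Matrix A A ℂ) ⊗ₖ N)ᴴ
      = pureOfCoeff (X * Nᵀ) := by
  have h : ((1 : Matrix A A ℂ) ⊗ₖ N) *ᵥ (fun p : A × B => X p.1 p.2)
      = fun p : A × C => (X * Nᵀ) p.1 p.2 := by
    ext p
    simp [mulVec, dotProduct, Fintype.sum_prod_type, Matrix.mul_apply, Matrix.one_apply, mul_comm]
  rw [pureOfCoeff_eq_vecMulVec, pureOfCoeff_eq_vecMulVec, mul_vecMulVec, vecMulVec_mul,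
    ← star_mulVec, h]

theorem Instrument.onAlice_pureOfCoeff {A B : Type} [Fintype A] [DecidableEq A] [Fintype B]
    [DecidableEq B] {n : ℕ} {C : Fin n → Type} [∀ i, Fintype (C i)] (𝓘 : Instrument A C)
    (i : Fin n) (X : Matrix A B ℂ) :
    𝓘.onAlice i (pureOfCoeff X) = ∑ k, pureOfCoeff (𝓘.M i k * X) := by
  simp [Instrument.onAlice, kronecker_one_mul_pureOfCoeff]

theorem Instrument.onBob_pureOfCoeff {A B : Type} [Fintype A] [DecidableEq A] [Fintype B]
    [DecidableEq B] {n : ℕ} {C : Fin n → Type} [∀ i, Fintype (C i)] (𝓘 : Instrument B C)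
    (i : Fin n) (X : Matrix A B ℂ) :
    𝓘.onBob i (pureOfCoeff X) = ∑ k, pureOfCoeff (X * (𝓘.M i k)ᵀ) := by
  simp [Instrument.onBob, one_kronecker_mul_pureOfCoeff]

theorem Instrument.onAlice_sum {A B ι : Type} [Fintype A] [DecidableEq A] [Fintype B]
    [DecidableEq B] {n : ℕ} {C : Fin n → Type} [∀ i, Fintype (C i)] (𝓘 : Instrument A C)
    (i : Fin n) (s : Finset ι) (ρ : ι → Matrix (A × B) (A × B) ℂ) :
    𝓘.onAlice i (∑ j ∈ s, ρ j) = ∑ j ∈ s, 𝓘.onAlice i (ρ j) := by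
  simp only [Instrument.onAlice, Matrix.mul_sum, Matrix.sum_mul]
  exact Finset.sum_comm

theorem Instrument.onBob_sum {A B ι : Type} [Fintype A] [DecidableEq A] [Fintype B]
    [DecidableEq B] {n : ℕ} {C : Fin n → Type} [∀ i, Fintype (C i)] (𝓘 : Instrument B C)
    (i : Fin n) (s : Finset ι) (ρ : ι → Matrix (A × B) (A × B) ℂ) :
    𝓘.onBob i (∑ j ∈ s, ρ j) = ∑ j ∈ s, 𝓘.onBob i (ρ j) := by
  simp only [Instrument.onBob, Matrix.mul_sum, Matrix.sum_mul]
  exact Finset.sum_comm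

/-- Needed because an outcome with several Kraus operators hands a sum of pure states to the rest of
the protocol. -/
theorem IsLOCC.map_sum {A₁ B₁ A B ι : Type}
    {Λ : Matrix (A × B) (A × B) ℂ → Matrix (A₁ × B₁) (A₁ × B₁) ℂ} (hΛ : IsLOCC Λ)
    (s : Finset ι) (ρ : ι → Matrix (A × B) (A × B) ℂ) :
    Λ (∑ j ∈ s, ρ j) = ∑ j ∈ s, Λ (ρ j) := by
  induction hΛ with
  | done => rfl
  | alice 𝓘 Λ _ ih =>
    simp only [Instrument.onAlice_sum, ih]
    exact Finset.sum_comm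
  | bob 𝓘 Λ _ ih =>
    simp only [Instrument.onBob_sum, ih]
    exact Finset.sum_comm

/-! ### Monotonicity of the operator norm under LOCC -/

open scoped Matrix.Norms.L2Operator

/-- Completeness splits `Xᴴ * X` into the Gram matrices of the branches; the C*-identity turns the
triangle inequality into the claim. -/
theorem sq_l2_opNorm_le_sum_mul {A B : Type} [Fintype A] [DecidableEq A] [Fintype B]
    [DecidableEq B] {n : ℕ} {C : Fin n → Type} [∀ i, Fintype (C i)] (𝓘 : Instrument A C)
    (X : Matrix A B ℂ) : ‖X‖ ^ 2 ≤ ∑ i, ∑ k, ‖𝓘.M i k * X‖ ^ 2 := by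
  have h : Xᴴ * X = ∑ i, ∑ k, (𝓘.M i k * X)ᴴ * (𝓘.M i k * X) := by
    calc Xᴴ * X = Xᴴ * (∑ i, ∑ k, (𝓘.M i k).conjTranspose * 𝓘.M i k) * X := by
          rw [𝓘.complete, Matrix.mul_one]
      _ = _ := by
          simp only [Matrix.mul_sum, Matrix.sum_mul, conjTranspose_mul, Matrix.mul_assoc]
  rw [sq, ← l2_opNorm_conjTranspose_mul_self, h]
  refine (norm_sum_le _ _).trans (Finset.sum_le_sum fun i _ => (norm_sum_le _ _).trans
    (Finset.sum_le_sum fun k _ => ?_))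
  rw [l2_opNorm_conjTranspose_mul_self, sq]

/-- Reduces Bob's steps to Alice's. Entrywise conjugation is norm-preserving, as seen by conjugating
the test vector, and the conjugate transpose is already known to be. -/
theorem l2_opNorm_transpose {A B : Type} [Fintype A] [DecidableEq A] [Fintype B]
    [DecidableEq B] (X : Matrix A B ℂ) : ‖Xᵀ‖ = ‖X‖ := by
  have key : ∀ {A B : Type} [Fintype A] [DecidableEq A] [Fintype B] [DecidableEq B]
      (X : Matrix A B ℂ), ‖X.map star‖ ≤ ‖X‖ := by
    intro A B _ _ _ _ X
    rw [l2_opNorm_def]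
    refine ContinuousLinearMap.opNorm_le_bound _ (norm_nonneg _) fun v => ?_
    have h1 := l2_opNorm_mulVec X (WithLp.toLp 2 (star v.ofLp))
    have h2 : ‖(WithLp.toLp 2 (star v.ofLp) : EuclideanSpace ℂ B)‖ = ‖v‖ := by
      simp [EuclideanSpace.norm_eq]
    rw [h2] at h1
    refine le_trans (le_of_eq ?_) h1
    have h3 : ∀ a, (X.map star *ᵥ v.ofLp) a = star ((X *ᵥ star v.ofLp) a) := by
      intro a
      simp [mulVec, dotProduct]
    simp only [EuclideanSpace.norm_eq]
    congr 1
    refine Finset.sum_congr rfl fun a _ => ?_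
    congr 1
    refine (congrArg norm (h3 a)).trans (norm_star _)
  have h : ‖X.map star‖ = ‖X‖ := le_antisymm (key X) (by
    have := key (X.map star)
    simpa [Matrix.map_map, Function.comp_def] using this)
  rw [← h, ← l2_opNorm_conjTranspose]
  rfl

/-- An LOCC protocol takes a pure state to a mixture of pure states, and the sum of their largest
squared Schmidt coefficients is no less than the initial one. -/
theorem IsLOCC.exists_pure_decomposition {A₁ B₁ A B : Type} [Fintype A₁] [DecidableEq A₁]
    [Fintype B₁] [DecidableEq B₁]
    {Λ : Matrix (A × B) (A × B) ℂ → Matrix (A₁ × B₁) (A₁ × B₁) ℂ} (hΛ : IsLOCC Λ) :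
    ∀ [Fintype A] [DecidableEq A] [Fintype B] [DecidableEq B] (X : Matrix A B ℂ),
      ∃ (ι : Type) (_ : Fintype ι) (Y : ι → Matrix A₁ B₁ ℂ),
        Λ (pureOfCoeff X) = ∑ j, pureOfCoeff (Y j) ∧ ‖X‖ ^ 2 ≤ ∑ j, ‖Y j‖ ^ 2 := by
  induction hΛ with
  | done =>
    intro _ _ _ _ X
    refine ⟨Unit, inferInstance, fun _ => X, by simp, ?_⟩
    simp only [Finset.univ_unique, Finset.sum_singleton]
    refine le_of_eq ?_
    congr!
  | @alice A B i₁ i₂ i₃ i₄ n C iC 𝓘 Λ hΛ ih =>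
    intro j₁ j₂ j₃ j₄ X
    -- The norms depend on the instances, so those of the constructor are identified with the
    -- quantified ones.
    obtain rfl := Subsingleton.elim i₁ j₁
    obtain rfl := Subsingleton.elim i₂ j₂
    obtain rfl := Subsingleton.elim i₃ j₃
    obtain rfl := Subsingleton.elim i₄ j₄
    classical
    choose ι hι Y h1 h2 using fun i k => ih i (𝓘.M i k * X)
    refine ⟨Σ i, Σ k, ι i k, inferInstance, fun x => Y x.1 x.2.1 x.2.2, ?_, ?_⟩
    · simp only [Instrument.onAlice_pureOfCoeff, (hΛ _).map_sum, h1, Fintype.sum_sigma]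
    · simp only [Fintype.sum_sigma]
      exact (sq_l2_opNorm_le_sum_mul 𝓘 X).trans
        (Finset.sum_le_sum fun i _ => Finset.sum_le_sum fun k _ => h2 i k)
  | @bob A B i₁ i₂ i₃ i₄ n C iC 𝓘 Λ hΛ ih =>
    intro j₁ j₂ j₃ j₄ X
    obtain rfl := Subsingleton.elim i₁ j₁
    obtain rfl := Subsingleton.elim i₂ j₂
    obtain rfl := Subsingleton.elim i₃ j₃
    obtain rfl := Subsingleton.elim i₄ j₄
    classical
    choose ι hι Y h1 h2 using fun i k => ih i (X * (𝓘.M i k)ᵀ)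
    refine ⟨Σ i, Σ k, ι i k, inferInstance, fun x => Y x.1 x.2.1 x.2.2, ?_, ?_⟩
    · simp only [Instrument.onBob_pureOfCoeff, (hΛ _).map_sum, h1, Fintype.sum_sigma]
    · simp only [Fintype.sum_sigma]
      have h3 := sq_l2_opNorm_le_sum_mul 𝓘 Xᵀ
      rw [l2_opNorm_transpose] at h3
      refine h3.trans (Finset.sum_le_sum fun i _ => Finset.sum_le_sum fun k _ => ?_)
      rw [← l2_opNorm_transpose, transpose_mul, transpose_transpose]
      exact h2 i k

/-! ### The largest Schmidt coefficient as eigenvalue and norm -/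

theorem eigenvalues_congr {E : Type*} [NormedAddCommGroup E] [InnerProductSpace ℂ E]
    [FiniteDimensional ℂ E] {n : ℕ} (hn : Module.finrank ℂ E = n) {S T : E →ₗ[ℂ] E} (h : S = T)
    (hS : S.IsSymmetric) (hT : T.IsSymmetric) : hS.eigenvalues hn = hT.eigenvalues hn := by
  subst h
  rfl

theorem maxSqSchmidt_eq_eigenvalues {A B : Type} [Fintype A] [Fintype B] [DecidableEq B]
    (Ψ : EuclideanSpace ℂ (A × B)) (h0 : 0 < Fintype.card B) :
    maxSqSchmidt Ψ = (isHermitian_conjTranspose_mul_self (coeffMatrix Ψ)).eigenvalues₀ ⟨0, h0⟩ := by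
  have h : LinearMap.adjoint (toEuclideanLin (coeffMatrix Ψ)) ∘ₗ toEuclideanLin (coeffMatrix Ψ)
      = toEuclideanLin ((coeffMatrix Ψ)ᴴ * coeffMatrix Ψ) := by
    classical
    rw [← toEuclideanLin_conjTranspose_eq_adjoint]
    ext v a
    simp [toEuclideanLin]
  unfold maxSqSchmidt schmidtCoeff
  change (toEuclideanLin (coeffMatrix Ψ)).singularValues 0 ^ 2 = _
  have hn : Module.finrank ℂ (EuclideanSpace ℂ B) = Fintype.card B := finrank_euclideanSpace
  refine (LinearMap.sq_singularValues_of_lt _ hn h0).trans ?_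
  exact congrFun (eigenvalues_congr hn h _ _) _

theorem eigenvalues_le_maxSqSchmidt {A B : Type} [Fintype A] [Fintype B] [DecidableEq B]
    (Ψ : EuclideanSpace ℂ (A × B)) (b : B) :
    (isHermitian_conjTranspose_mul_self (coeffMatrix Ψ)).eigenvalues b ≤ maxSqSchmidt Ψ := by
  rw [maxSqSchmidt_eq_eigenvalues Ψ (Fintype.card_pos_iff.2 ⟨b⟩)]
  exact (isHermitian_conjTranspose_mul_self (coeffMatrix Ψ)).eigenvalues₀_antitone
    (Fin.mk_le_of_le_val (Nat.zero_le _))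

/-- A unit eigenvector for the top eigenvalue of `Xᴴ * X` tests the norm of that matrix, which is
`‖X‖ ^ 2`. -/
theorem maxSqSchmidt_le_sq_l2_opNorm {A B : Type} [Fintype A] [Fintype B] [DecidableEq B]
    (Ψ : EuclideanSpace ℂ (A × B)) : maxSqSchmidt Ψ ≤ ‖coeffMatrix Ψ‖ ^ 2 := by
  rcases Nat.eq_zero_or_pos (Fintype.card B) with h0 | h0
  · have : maxSqSchmidt Ψ = 0 := by
      unfold maxSqSchmidt schmidtCoeff
      rw [LinearMap.singularValues_of_finrank_le] <;> simp [h0]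
    rw [this]
    positivity
  · have hH := isHermitian_conjTranspose_mul_self (coeffMatrix Ψ)
    obtain ⟨b, hb⟩ : ∃ b, hH.eigenvalues b = hH.eigenvalues₀ ⟨0, h0⟩ :=
      ⟨(Fintype.equivOfCardEq (Fintype.card_fin _)) ⟨0, h0⟩, by
        simp [IsHermitian.eigenvalues]⟩
    rw [maxSqSchmidt_eq_eigenvalues Ψ h0, ← hb, sq, ← l2_opNorm_conjTranspose_mul_self]
    have h1 := l2_opNorm_mulVec ((coeffMatrix Ψ)ᴴ * coeffMatrix Ψ) (hH.eigenvectorBasis b)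
    rw [hH.mulVec_eigenvectorBasis] at h1
    have h2 : ‖hH.eigenvectorBasis b‖ = 1 := hH.eigenvectorBasis.orthonormal.1 b
    change ‖hH.eigenvalues b • hH.eigenvectorBasis b‖ ≤ _ at h1
    rw [norm_smul, h2, mul_one, mul_one] at h1
    exact (le_abs_self _).trans h1

/-! ### Mixtures equal to `Φ⁺ ⊗ σ`, and necessity -/

theorem norm_dotProduct_sq_le {L : Type} [Fintype L] (x y : L → ℂ) :
    ‖x ⬝ᵥ y‖ ^ 2 ≤ (∑ l, ‖x l‖ ^ 2) * ∑ l, ‖y l‖ ^ 2 := by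
  have h : ‖x ⬝ᵥ y‖ ≤ ∑ l, ‖x l‖ * ‖y l‖ := by
    refine (norm_sum_le _ _).trans (le_of_eq ?_)
    simp
  exact (pow_le_pow_left₀ (norm_nonneg _) h 2).trans (Finset.sum_mul_sq_le_sq_mul_sq _ _ _)

/-- A matrix of the form `1 ⊗ χ` with the qubit identity has squared operator norm at most half
its squared Hilbert-Schmidt norm. -/
theorem sq_l2_opNorm_le_half_of_block {J L : Type} [Fintype J] [Fintype L] [DecidableEq L]
    (Y : Matrix (Fin 2 × J) (Fin 2 × L) ℂ) (h01 : ∀ j l, Y (0, j) (1, l) = 0)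
    (h10 : ∀ j l, Y (1, j) (0, l) = 0) (h11 : ∀ j l, Y (1, j) (1, l) = Y (0, j) (0, l)) :
    ‖Y‖ ^ 2 ≤ 1 / 2 * ∑ p : (Fin 2 × J) × (Fin 2 × L), ‖Y p.1 p.2‖ ^ 2 := by
  -- `F` is the squared Hilbert-Schmidt norm of one block `χ`. It bounds the squared operator norm,
  -- while the two equal blocks give `2 * F` in total.
  set F : ℝ := ∑ j, ∑ l, ‖Y (0, j) (0, l)‖ ^ 2 with hF
  have hF0 : 0 ≤ F := by positivity
  have hsum : ∑ p : (Fin 2 × J) × (Fin 2 × L), ‖Y p.1 p.2‖ ^ 2 = 2 * F := by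
    simp [Fintype.sum_prod_type, Fin.sum_univ_two, h01, h10, h11]
    ring
  rw [hsum]
  suffices h : ‖Y‖ ≤ √F by
    calc ‖Y‖ ^ 2 ≤ √F ^ 2 := pow_le_pow_left₀ (norm_nonneg _) h 2
      _ = 1 / 2 * (2 * F) := by rw [Real.sq_sqrt hF0]; ring
  rw [l2_opNorm_def]
  refine ContinuousLinearMap.opNorm_le_bound _ (Real.sqrt_nonneg _) fun v => ?_
  change ‖(WithLp.toLp 2 (Y *ᵥ v.ofLp) : EuclideanSpace ℂ (Fin 2 × J))‖ ≤ _
  rw [EuclideanSpace.norm_eq, EuclideanSpace.norm_eq, ← Real.sqrt_mul hF0]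
  refine Real.sqrt_le_sqrt ?_
  have hb : ∀ (a : Fin 2) (j : J), ‖(Y *ᵥ v.ofLp) (a, j)‖ ^ 2
      ≤ (∑ l, ‖Y (0, j) (0, l)‖ ^ 2) * ∑ l, ‖v (a, l)‖ ^ 2 := by
    intro a j
    have : (Y *ᵥ v.ofLp) (a, j) = (fun l => Y (0, j) (0, l)) ⬝ᵥ fun l => v (a, l) := by
      fin_cases a <;>
        simp [mulVec, dotProduct, Fintype.sum_prod_type, Fin.sum_univ_two, h01, h10, h11]
    rw [this]
    exact norm_dotProduct_sq_le _ _
  calc ∑ i, ‖(Y *ᵥ v.ofLp) i‖ ^ 2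
      ≤ ∑ a : Fin 2, ∑ j, (∑ l, ‖Y (0, j) (0, l)‖ ^ 2) * ∑ l, ‖v (a, l)‖ ^ 2 := by
        rw [Fintype.sum_prod_type]
        exact Finset.sum_le_sum fun a _ => Finset.sum_le_sum fun j _ => hb a j
    _ = F * ∑ i, ‖v i‖ ^ 2 := by
        rw [Fintype.sum_prod_type, hF, Finset.mul_sum]
        exact Finset.sum_congr rfl fun a _ => (Finset.sum_mul _ _ _).symm

theorem eq_zero_of_sum_mul_star_eq_zero {ι : Type} [Fintype ι] {f : ι → ℂ}
    (h : ∑ i, f i * star (f i) = 0) (i : ι) : f i = 0 := by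
  have h1 : ∑ i, ‖f i‖ ^ 2 = 0 := by
    have : ∀ i, f i * star (f i) = ((‖f i‖ ^ 2 : ℝ) : ℂ) := fun i => by
      simp [Complex.mul_conj']
    simp only [this] at h
    exact_mod_cast h
  have := (Finset.sum_eq_zero_iff_of_nonneg fun i _ => by positivity).1 h1 i (Finset.mem_univ i)
  simpa using this

theorem trace_pureOfCoeff {A B : Type} [Fintype A] [Fintype B] (X : Matrix A B ℂ) :
    (pureOfCoeff X).trace = ((∑ p : A × B, ‖X p.1 p.2‖ ^ 2 : ℝ) : ℂ) := by
  simp [Matrix.trace, pureOfCoeff, Complex.mul_conj']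

theorem bell_mul_self : ((1 / √2 : ℝ) : ℂ) * ((1 / √2 : ℝ) : ℂ) = 1 / 2 := by
  rw [← Complex.ofReal_mul, div_mul_div_comm, Real.mul_self_sqrt (by norm_num)]
  norm_num

theorem trace_bipartiteTensor_bell {J L : Type} [Fintype J] [Fintype L]
    (σ : Matrix (J × L) (J × L) ℂ) :
    (bipartiteTensor (pureDensity bellState) σ).trace = σ.trace := by
  have h := bell_mul_self
  simp only [Matrix.trace, Matrix.diag_apply, bipartiteTensor, pureDensity, bellState,
    Fintype.sum_prod_type, Fin.sum_univ_two, Matrix.of_apply, Complex.star_def]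
  simp only [if_true, one_ne_zero, zero_ne_one, if_false, zero_mul,
    Complex.conj_ofReal, h, Finset.sum_const_zero, 
    map_zero, ← Finset.mul_sum, add_zero, zero_add]
  ring

/-- A mixture of pure states that equals `Φ⁺ ⊗ σ` consists of states whose largest squared
Schmidt coefficient is at most half their squared norm. -/
theorem sum_sq_l2_opNorm_le_half {J L ι : Type} [Fintype J] [Fintype L] [DecidableEq L]
    [Fintype ι] (σ : Matrix (J × L) (J × L) ℂ) (hσ : σ.trace = 1)
    (Y : ι → Matrix (Fin 2 × J) (Fin 2 × L) ℂ)
    (h : bipartiteTensor (pureDensity bellState) σ = ∑ i, pureOfCoeff (Y i)) :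
    ∑ i, ‖Y i‖ ^ 2 ≤ 1 / 2 := by
  have hentry : ∀ p q, bipartiteTensor (pureDensity bellState) σ p q
      = ∑ i, Y i p.1 p.2 * star (Y i q.1 q.2) := by
    intro p q
    rw [h, Matrix.sum_apply]
    rfl
  have htr : ∑ i, ∑ p : (Fin 2 × J) × (Fin 2 × L), ‖Y i p.1 p.2‖ ^ 2 = 1 := by
    have h1 := trace_bipartiteTensor_bell σ
    rw [h, hσ, Matrix.trace_sum] at h1
    simp only [trace_pureOfCoeff] at h1
    exact_mod_cast h1
  -- A vanishing diagonal entry of the mixture is a sum of squared moduli, so it vanishes in every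
  -- component.
  have h01 : ∀ i j l, Y i (0, j) (1, l) = 0 := fun i j l =>
    eq_zero_of_sum_mul_star_eq_zero (f := fun i => Y i (0, j) (1, l)) (by
      rw [← hentry ((0, j), (1, l)) ((0, j), (1, l))]
      simp [bipartiteTensor, pureDensity, bellState]) i
  have h10 : ∀ i j l, Y i (1, j) (0, l) = 0 := fun i j l =>
    eq_zero_of_sum_mul_star_eq_zero (f := fun i => Y i (1, j) (0, l)) (by
      rw [← hentry ((1, j), (0, l)) ((1, j), (0, l))]
      simp [bipartiteTensor, pureDensity, bellState]) i
  -- Same argument for the expectation of `Φ⁺ ⊗ σ` in the unnormalized vector `|11⟩ - |00⟩` tensored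
  -- with `|j l⟩`.
  have h11 : ∀ i j l, Y i (1, j) (1, l) = Y i (0, j) (0, l) := fun i j l => by
    refine sub_eq_zero.1 (eq_zero_of_sum_mul_star_eq_zero
      (f := fun i => Y i (1, j) (1, l) - Y i (0, j) (0, l)) ?_ i)
    have e1 := hentry ((1, j), (1, l)) ((1, j), (1, l))
    have e2 := hentry ((1, j), (1, l)) ((0, j), (0, l))
    have e3 := hentry ((0, j), (0, l)) ((1, j), (1, l))
    have e4 := hentry ((0, j), (0, l)) ((0, j), (0, l))
    simp only [star_sub, mul_sub, sub_mul, Finset.sum_sub_distrib]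
    rw [← e1, ← e2, ← e3, ← e4]
    simp [bipartiteTensor, pureDensity, bellState]
  calc ∑ i, ‖Y i‖ ^ 2
      ≤ ∑ i, 1 / 2 * ∑ p : (Fin 2 × J) × (Fin 2 × L), ‖Y i p.1 p.2‖ ^ 2 :=
        Finset.sum_le_sum fun i _ => sq_l2_opNorm_le_half_of_block (Y i) (h01 i) (h10 i) (h11 i)
    _ = 1 / 2 := by rw [← Finset.mul_sum, htr, mul_one]

/-- Deterministic restoration of a Bell pair needs a largest squared Schmidt coefficient of at
most one half. -/
theorem CanRestoreBellPair.maxSqSchmidt_le {A B : Type} [Fintype A] [Fintype B] [DecidableEq B]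
    {Ψ : EuclideanSpace ℂ (A × B)} (h : CanRestoreBellPair Ψ) : maxSqSchmidt Ψ ≤ 1 / 2 := by
  classical
  obtain ⟨J, L, _, _, Λ, σ, hΛ, hσ, hf⟩ := h
  obtain ⟨ι, _, Y, h1, h2⟩ := hΛ.exists_pure_decomposition (coeffMatrix Ψ)
  rw [← pureDensity_eq_pureOfCoeff, hf] at h1
  exact (maxSqSchmidt_le_sq_l2_opNorm Ψ).trans
    (h2.trans (sum_sq_l2_opNorm_le_half σ hσ.2 Y h1))

/-! ### Weighted graphs with prescribed degrees -/

/-- A nonnegative vector none of whose entries exceeds half the total is the degree sequence of a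
weighted graph without loops. -/
theorem exists_symmetric_weights {ι : Type} [Fintype ι] [DecidableEq ι] (d : ι → ℝ)
    (h0 : ∀ i, 0 ≤ d i) (hd : ∀ i, 2 * d i ≤ ∑ j, d j) :
    ∃ p : ι → ι → ℝ, (∀ i j, 0 ≤ p i j) ∧ (∀ i j, p i j = p j i) ∧ (∀ i, p i i = 0) ∧
      ∀ i, ∑ j, p i j = d i := by
  induction hn : (Finset.univ.filter fun i => d i ≠ 0).card using Nat.strong_induction_on
    generalizing d with
  | _ n ih =>
  -- When one entry is exactly half the total, the star centred there works.
  have star : ∀ d : ι → ℝ, (∀ i, 0 ≤ d i) → (∃ k, 2 * d k = ∑ j, d j) →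
      ∃ p : ι → ι → ℝ, (∀ i j, 0 ≤ p i j) ∧ (∀ i j, p i j = p j i) ∧ (∀ i, p i i = 0) ∧
        ∀ i, ∑ j, p i j = d i := by
    rintro d h0 ⟨k, hk⟩
    refine ⟨fun i j => if i = j then 0 else if i = k then d j else if j = k then d i else 0,
      ?_, ?_, by simp, ?_⟩
    · intro i j
      dsimp only
      split_ifs <;> first | exact le_rfl | exact h0 _
    · intro i j
      dsimp only
      split_ifs <;> simp_all
    · intro i
      by_cases hik : i = k
      · subst hik
        have h1 : ∀ j, (if i = j then 0 else if i = i then d j else if j = i then d i else 0)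
            = d j - if i = j then d j else 0 := by
          intro j
          split_ifs <;> simp_all
        refine (Finset.sum_congr rfl fun j _ => h1 j).trans ?_
        simp only [Finset.sum_sub_distrib, Finset.sum_ite_eq, Finset.mem_univ, if_true]
        linarith
      · have h1 : ∀ j, (if i = j then 0 else if i = k then d j else if j = k then d i else 0)
            = if j = k then d i else 0 := by
          intro j
          split_ifs <;> simp_all
        simp [h1]
  by_cases htight : ∃ k, 2 * d k = ∑ j, d j
  · exact star d h0 htight
  push Not at htight
  have hlt : ∀ i, 2 * d i < ∑ j, d j := fun i => lt_of_le_of_ne (hd i) (htight i)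
  by_cases hz : ∀ i, d i = 0
  · exact ⟨fun _ _ => 0, by simp, by simp, by simp, by simp [hz]⟩
  push Not at hz
  obtain ⟨i, hi⟩ := hz
  have hipos : 0 < d i := lt_of_le_of_ne (h0 i) (Ne.symm hi)
  obtain ⟨j, hij, hj⟩ : ∃ j, j ≠ i ∧ d j ≠ 0 := by
    by_contra! hcon
    have := Finset.sum_eq_single (s := Finset.univ) (f := d) i (fun j _ hj => hcon j hj) (by simp)
    linarith [hlt i]
  have hjpos : 0 < d j := lt_of_le_of_ne (h0 j) (Ne.symm hj)
  set S := ∑ j, d j with hS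
  have hne : (Finset.univ.filter fun l => l ≠ i ∧ l ≠ j).Nonempty := by
    by_contra! hcon
    have : S = d i + d j := Finset.sum_eq_add i j hij.symm
      (fun l _ hl => absurd hl (Finset.filter_eq_empty_iff.1 hcon (Finset.mem_univ l)))
      (by simp) (by simp)
    linarith [hlt i, hlt j]
  obtain ⟨k, hkm, hk⟩ := Finset.exists_min_image _ (fun k => S / 2 - d k) hne
  obtain ⟨hki, hkj⟩ := (Finset.mem_filter.1 hkm).2
  -- The largest weight that the edge `{i, j}` can take: `d i` and `d j` stay nonnegative, and no
  -- other entry exceeds half of the new total `S - 2 * t`; `k` is the largest of these others.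
  set t := min (min (d i) (d j)) (S / 2 - d k) with ht
  have htpos : 0 < t := by
    refine lt_min (lt_min hipos hjpos) ?_
    linarith [hlt k]
  have hti : t ≤ d i := (min_le_left _ _).trans (min_le_left _ _)
  have htj : t ≤ d j := (min_le_left _ _).trans (min_le_right _ _)
  have htk : ∀ l, l ≠ i → l ≠ j → t ≤ S / 2 - d l := fun l h1 h2 =>
    (min_le_right _ _).trans (hk l (Finset.mem_filter.2 ⟨Finset.mem_univ l, h1, h2⟩))
  let e : ι → ℝ := fun l => (if l = i then t else 0) + if l = j then t else 0
  have hei : e i = t := by simp [e, hij.symm]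
  have hej : e j = t := by simp [e, hij]
  have hel : ∀ l, l ≠ i → l ≠ j → e l = 0 := fun l h1 h2 => by simp [e, h1, h2]
  have hesum : ∑ l, e l = 2 * t := by
    simp [e, Finset.sum_add_distrib]
    ring
  have he0 : ∀ l, 0 ≤ e l := by
    intro l
    dsimp only [e]
    split_ifs <;> linarith
  have hsum' : ∑ l, (d l - e l) = S - 2 * t := by rw [Finset.sum_sub_distrib, hesum]
  have h0' : ∀ l, 0 ≤ d l - e l := by
    intro l
    by_cases h1 : l = i
    · subst h1; linarith
    by_cases h2 : l = j
    · subst h2; linarith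
    rw [hel l h1 h2, sub_zero]
    exact h0 l
  have hd' : ∀ l, 2 * (d l - e l) ≤ ∑ l, (d l - e l) := by
    intro l
    rw [hsum']
    by_cases h1 : l = i
    · subst h1
      linarith [hd l]
    by_cases h2 : l = j
    · subst h2
      linarith [hd l]
    linarith [htk l h1 h2, he0 l]
  suffices hq : ∃ p : ι → ι → ℝ, (∀ i j, 0 ≤ p i j) ∧ (∀ i j, p i j = p j i) ∧ (∀ i, p i i = 0) ∧
      ∀ l, ∑ j, p l j = d l - e l by
    obtain ⟨p, p0, ps, pd, psum⟩ := hq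
    refine ⟨fun a b => p a b + if (a = i ∧ b = j) ∨ (a = j ∧ b = i) then t else 0, ?_, ?_, ?_, ?_⟩
    · intro a b
      have := p0 a b
      dsimp only
      split_ifs <;> linarith
    · intro a b
      dsimp only
      rw [ps a b]
      congr 1
      exact if_congr (by tauto) rfl rfl
    · intro a
      dsimp only
      rw [pd, if_neg, zero_add]
      rintro (⟨h1, h2⟩ | ⟨h1, h2⟩)
      · exact hij (h2.symm.trans h1)
      · exact hij (h1.symm.trans h2)
    · intro a
      rw [Finset.sum_add_distrib, psum]
      have h1 : ∑ b, (if (a = i ∧ b = j) ∨ (a = j ∧ b = i) then t else 0) = e a := by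
        by_cases ha : a = i
        · subst ha
          simp [hei, hij.symm]
        by_cases ha' : a = j
        · subst ha'
          simp [hej, hij]
        simp [ha, ha', hel a ha ha']
      rw [h1]
      ring
  -- Either `i` or `j` leaves the support and induction applies, or `k` reaches half the new total
  -- and the star applies.
  by_cases hcase : d i = t ∨ d j = t
  · refine ih _ ?_ (fun l => d l - e l) h0' hd' rfl
    rw [← hn]
    refine Finset.card_lt_card (Finset.ssubset_iff_subset_ne.2 ⟨?_, ?_⟩)
    · intro l hl
      simp only [Finset.mem_filter, Finset.mem_univ, true_and] at hl ⊢
      intro hdl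
      have := h0' l
      have := he0 l
      exact hl (by linarith)
    · intro heq
      rcases hcase with hc | hc
      · have : i ∈ Finset.univ.filter fun l => d l - e l ≠ 0 := by rw [heq]; simp [hi]
        simp [hei, hc] at this
      · have : j ∈ Finset.univ.filter fun l => d l - e l ≠ 0 := by rw [heq]; simp [hj]
        simp [hej, hc] at this
  · push Not at hcase
    have htS : t = S / 2 - d k := by
      rcases min_choice (min (d i) (d j)) (S / 2 - d k) with h | h
      · rcases min_choice (d i) (d j) with h' | h'
        · exact absurd (ht.trans (h.trans h')).symm hcase.1
        · exact absurd (ht.trans (h.trans h')).symm hcase.2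
      · exact ht.trans h
    refine star _ h0' ⟨k, le_antisymm (hd' k) ?_⟩
    rw [hsum']
    rw [hel k hki hkj]
    linarith

/-! ### Building blocks of the protocol -/

theorem exists_isLOCC_bob_channel {A B C κ : Type} [Fintype A] [DecidableEq A] [Fintype B]
    [DecidableEq B] [Fintype C] [Fintype κ] (N : κ → Matrix C B ℂ) (hN : ∑ k, (N k)ᴴ * N k = 1) :
    ∃ Λ : Matrix (A × B) (A × B) ℂ → Matrix (A × C) (A × C) ℂ,
      IsLOCC Λ ∧ ∀ X, Λ (pureOfCoeff X) = ∑ k, pureOfCoeff (X * (N k)ᵀ) := by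
  let 𝓘 : Instrument B (fun _ : Fin 1 => C) :=
    { r := fun _ => Fintype.card κ
      M := fun _ k => N ((Fintype.equivFin κ).symm k)
      complete := by
        rw [Fin.sum_univ_one, ← hN]
        exact (Fintype.equivFin κ).symm.sum_comp fun k => (N k)ᴴ * N k }
  refine ⟨_, IsLOCC.bob 𝓘 (fun _ ρ => ρ) fun _ => IsLOCC.done, fun X => ?_⟩
  simp only [Fin.sum_univ_one, Instrument.onBob_pureOfCoeff]
  exact (Fintype.equivFin κ).symm.sum_comp fun k => pureOfCoeff (X * (N k)ᵀ)

/-- One Kraus operator per announced outcome, so each branch stays pure and has its own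
continuation. -/
theorem exists_isLOCC_alice_measurement {A₁ B₁ A B C κ : Type} [Fintype A] [DecidableEq A]
    [Fintype B] [DecidableEq B] [Fintype C] [Fintype κ] (M : κ → Matrix C A ℂ)
    (hM : ∑ k, (M k)ᴴ * M k = 1)
    (Λ : κ → Matrix (C × B) (C × B) ℂ → Matrix (A₁ × B₁) (A₁ × B₁) ℂ) (hΛ : ∀ k, IsLOCC (Λ k)) :
    ∃ Λ' : Matrix (A × B) (A × B) ℂ → Matrix (A₁ × B₁) (A₁ × B₁) ℂ,
      IsLOCC Λ' ∧ ∀ X, Λ' (pureOfCoeff X) = ∑ k, Λ k (pureOfCoeff (M k * X)) := by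
  let e := (Fintype.equivFin κ).symm
  let 𝓘 : Instrument A (fun _ : Fin (Fintype.card κ) => C) :=
    { r := fun _ => 1
      M := fun i _ => M (e i)
      complete := by
        simp only [Fin.sum_univ_one]
        rw [← hM]
        exact e.sum_comp fun k => (M k)ᴴ * M k }
  refine ⟨_, IsLOCC.alice 𝓘 (fun i => Λ (e i)) fun i => hΛ _, fun X => ?_⟩
  simp only [Instrument.onAlice_pureOfCoeff]
  have h : ∀ i : Fin (Fintype.card κ), ∑ k, pureOfCoeff (𝓘.M i k * X) = pureOfCoeff (M (e i) * X) :=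
    fun i => Fin.sum_univ_one _
  simp only [h]
  exact e.sum_comp fun k => Λ k (pureOfCoeff (M k * X))

/-- The operator `|0⟩⟨i| + |1⟩⟨j|`. -/
def pairMatrix {B : Type} [DecidableEq B] (i j : B) : Matrix (Fin 2 × Unit) B ℂ :=
  Matrix.of fun a b => if b = (if a.1 = 0 then i else j) then 1 else 0

theorem pairMatrix_mul_transpose {B : Type} [Fintype B] [DecidableEq B] {i j : B} (h : i ≠ j) :
    pairMatrix i j * (pairMatrix i j)ᵀ = 1 := by
  ext ⟨a, _⟩ ⟨b, _⟩
  fin_cases a <;> fin_cases b <;> simp [pairMatrix, Matrix.mul_apply, h, h.symm]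

theorem pairMatrix_conjTranspose_mul {B : Type} [DecidableEq B] {i j : B} (h : i ≠ j) :
    (pairMatrix i j)ᴴ * pairMatrix i j
      = diagonal fun b => (if b = i then 1 else 0) + if b = j then 1 else 0 := by
  ext a b
  simp only [Matrix.mul_apply, Fintype.sum_prod_type, Fin.sum_univ_two, Finset.univ_unique,
    Finset.sum_singleton, pairMatrix, conjTranspose_apply, Matrix.of_apply, diagonal_apply]
  simp only [if_true, one_ne_zero, if_false]
  split_ifs <;> simp_all

theorem pairMatrix_mul_single {B : Type} [Fintype B] [DecidableEq B] {i j k : B} (hi : k ≠ i)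
    (hj : k ≠ j) (c : Fin 2 × Unit) :
    pairMatrix i j * (Matrix.single c k (1 : ℂ))ᵀ = 0 := by
  ext ⟨a, _⟩ b
  simp only [pairMatrix, Matrix.mul_apply, transpose_apply, Matrix.of_apply, Matrix.zero_apply]
  refine Finset.sum_eq_zero fun l _ => ?_
  by_cases hl : l = k
  · subst hl
    rw [if_neg, zero_mul]
    split_ifs <;> assumption
  · rw [Matrix.single_apply_of_col_ne _ _ (Ne.symm hl), mul_zero]

theorem pairMatrix_mul_diagonal {B : Type} [Fintype B] [DecidableEq B] {i j : B} {f : B → ℂ}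
    (hi : f i = 1) (hj : f j = 1) : pairMatrix i j * diagonal f = pairMatrix i j := by
  ext ⟨a, _⟩ b
  simp only [mul_diagonal, pairMatrix, Matrix.of_apply]
  split_ifs <;> simp_all

theorem sum_single_conjTranspose_mul {B : Type} [Fintype B] [DecidableEq B] (c : Fin 2 × Unit) :
    ∑ k : B, (Matrix.single c k (1 : ℂ))ᴴ * Matrix.single c k (1 : ℂ) = 1 := by
  simp only [conjTranspose_single, single_mul_single_same, star_one, mul_one]
  ext a b
  simp [Matrix.sum_apply, Matrix.single_apply, Matrix.one_apply, ite_and]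

/-- Bob can map `|i⟩, |j⟩` to the qubit states `|0⟩, |1⟩`. -/
theorem exists_isLOCC_of_pairMatrix {B : Type} [Fintype B] [DecidableEq B] {i j : B} (h : i ≠ j)
    {U : Matrix B B ℂ} (hU : Uᴴ * U = 1) :
    ∃ Λ : Matrix ((Fin 2 × Unit) × B) ((Fin 2 × Unit) × B) ℂ →
        Matrix ((Fin 2 × Unit) × (Fin 2 × Unit)) ((Fin 2 × Unit) × (Fin 2 × Unit)) ℂ,
      IsLOCC Λ ∧ ∀ c : ℂ, Λ (pureOfCoeff (c • (pairMatrix i j * Uᴴ))) = pureOfCoeff (c • 1) := by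
  have hU' : U * Uᴴ = 1 := mul_eq_one_comm.1 hU
  -- The pair operator is completed to a channel by sending every other basis vector to `|0⟩`; these
  -- extra operators annihilate the state at hand.
  let G : Option B → Matrix (Fin 2 × Unit) B ℂ := fun k => k.elim (pairMatrix i j) fun k =>
    if k = i ∨ k = j then 0 else Matrix.single (0, ()) k 1
  have hG : ∑ k, (G k)ᴴ * G k = 1 := by
    have hs : ∀ k : B, (G (some k))ᴴ * G (some k)
        = diagonal fun b => if b = k ∧ k ≠ i ∧ k ≠ j then 1 else 0 := by
      intro k
      by_cases hk : k = i ∨ k = j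
      · have : ∀ b, ¬ (b = k ∧ k ≠ i ∧ k ≠ j) := by tauto
        simp [G, hk, this]
      · ext a b
        simp only [G, Option.elim, hk, if_false, conjTranspose_single, single_mul_single_same,
          star_one, mul_one, Matrix.single_apply, diagonal_apply]
        push Not at hk
        simp only [hk, ne_eq, not_false_eq_true, and_true]
        by_cases hab : a = b
        · subst hab
          simp [eq_comm]
        · rw [if_neg, if_neg hab]
          rintro ⟨rfl, h1⟩
          exact hab h1
    rw [Fintype.sum_option]
    simp only [hs]
    rw [show (G none)ᴴ * G none = _ from pairMatrix_conjTranspose_mul h]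
    ext a b
    by_cases hab : a = b
    · subst hab
      simp only [Matrix.add_apply, Matrix.sum_apply, diagonal_apply_eq, Matrix.one_apply_eq,
        ite_and, Finset.sum_ite_eq, Finset.mem_univ, if_true]
      split_ifs <;> simp_all
    · simp [Matrix.add_apply, Matrix.sum_apply, hab]
  -- Bob's operators act transposed, so `Uᵀ` contributes the factor `U` that cancels `Uᴴ`.
  obtain ⟨Λ, hΛ, hX⟩ := exists_isLOCC_bob_channel (A := Fin 2 × Unit) (fun k => G k * Uᵀ) (by
    have : ∀ k, (G k * Uᵀ)ᴴ * (G k * Uᵀ) = Uᵀᴴ * ((G k)ᴴ * G k) * Uᵀ := by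
      intro k
      simp only [conjTranspose_mul, Matrix.mul_assoc]
    simp only [this]
    rw [← Matrix.sum_mul, ← Matrix.mul_sum, hG, Matrix.mul_one, show Uᵀᴴ = Uᴴᵀ from rfl,
      ← transpose_mul, hU', transpose_one])
  refine ⟨Λ, hΛ, fun c => ?_⟩
  have h1 : ∀ k, c • (pairMatrix i j * Uᴴ) * (G k * Uᵀ)ᵀ = c • (pairMatrix i j * (G k)ᵀ) := by
    intro k
    rw [transpose_mul, transpose_transpose, Matrix.smul_mul, Matrix.mul_assoc,
      ← Matrix.mul_assoc Uᴴ, hU, Matrix.one_mul]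
  have h2 : ∀ k, pureOfCoeff (c • (pairMatrix i j * (G (some k))ᵀ)) = 0 := by
    intro k
    by_cases hk : k = i ∨ k = j
    · simp [G, hk]
    · simp only [G, Option.elim, hk, if_false]
      push Not at hk
      rw [pairMatrix_mul_single hk.1 hk.2, smul_zero, pureOfCoeff_zero]
  rw [hX]
  simp only [h1]
  rw [Fintype.sum_option, Finset.sum_eq_zero fun k _ => h2 k, add_zero]
  change pureOfCoeff (c • (pairMatrix i j * (pairMatrix i j)ᵀ)) = _
  rw [pairMatrix_mul_transpose h]

theorem IsLOCC.map_zero {A₁ B₁ A B : Type}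
    {Λ : Matrix (A × B) (A × B) ℂ → Matrix (A₁ × B₁) (A₁ × B₁) ℂ} (hΛ : IsLOCC Λ) : Λ 0 = 0 := by
  simpa using hΛ.map_sum (∅ : Finset Unit) fun _ => 0

theorem pureOfCoeff_one : pureOfCoeff (1 : Matrix (Fin 2 × Unit) (Fin 2 × Unit) ℂ)
    = (2 : ℂ) • bipartiteTensor (pureDensity bellState) (1 : Matrix (Unit × Unit) _ ℂ) := by
  have h := bell_mul_self
  ext ⟨⟨a, _⟩, ⟨b, _⟩⟩ ⟨⟨c, _⟩, ⟨d, _⟩⟩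
  simp only [pureOfCoeff, bipartiteTensor, pureDensity, bellState, Matrix.of_apply,
    Matrix.one_apply, Prod.mk.injEq, and_true, Matrix.smul_apply, Complex.star_def, smul_eq_mul]
  by_cases h1 : a = b <;> by_cases h2 : c = d <;> (
    simp only [h1, h2, if_true, if_false, map_zero, map_one, Complex.conj_ofReal, h, mul_zero,
      zero_mul, mul_one]
    try norm_num)

/-- The half compensates for ordered pairs: each vertex collects half its row sum and half its
column sum. Loops, where the pair operator degenerates, have weight zero. -/
theorem sum_smul_pairMatrix {B : Type} [Fintype B] [DecidableEq B] {p : B → B → ℝ} {d : B → ℝ}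
    (hs : ∀ i j, p i j = p j i) (hz : ∀ i, p i i = 0) (hd : ∀ i, ∑ j, p i j = d i) :
    ∑ q : B × B, ((p q.1 q.2 / 2 : ℝ) : ℂ) • ((pairMatrix q.1 q.2)ᴴ * pairMatrix q.1 q.2)
      = diagonal fun b => (d b : ℂ) := by
  have h : ∀ q : B × B,
      ((p q.1 q.2 / 2 : ℝ) : ℂ) • ((pairMatrix q.1 q.2)ᴴ * pairMatrix q.1 q.2)
      = diagonal fun b => (if b = q.1 then ((p b q.2 / 2 : ℝ) : ℂ) else 0)
          + if b = q.2 then ((p q.1 b / 2 : ℝ) : ℂ) else 0 := by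
    rintro ⟨i, j⟩
    by_cases hij : i = j
    · subst hij
      ext a b
      simp only [hz, diagonal_apply]
      split_ifs <;> simp_all
    · rw [pairMatrix_conjTranspose_mul hij, ← diagonal_smul]
      congr 1
      ext b
      simp only [Pi.smul_apply, smul_eq_mul]
      split_ifs <;> simp_all
  simp only [h]
  ext a b
  by_cases hab : a = b
  · subst hab
    simp only [Matrix.sum_apply, diagonal_apply_eq, Finset.sum_add_distrib]
    rw [Fintype.sum_prod_type, Fintype.sum_prod_type_right]
    simp only [Finset.sum_ite_irrel, Finset.sum_const_zero, Finset.sum_ite_eq, Finset.mem_univ,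
      if_true]
    rw [← Complex.ofReal_sum, ← Complex.ofReal_sum, ← Complex.ofReal_add, ← Finset.sum_div,
      ← Finset.sum_div, hd]
    simp only [fun i => hs i a, hd]
    rw [add_halves]
  · simp [Matrix.sum_apply, hab]

/-! ### The conversion protocol and sufficiency -/

/-- A bipartite vector none of whose squared Schmidt coefficients exceeds half their sum is
converted to a multiple of a Bell pair by LOCC. -/
theorem exists_isLOCC_to_bell {A B : Type} [Fintype A] [DecidableEq A] [Fintype B] [DecidableEq B]
    (X : Matrix A B ℂ) {U : Matrix B B ℂ} (hU : Uᴴ * U = 1) {d : B → ℝ}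
    (hX : (X * U)ᴴ * (X * U) = diagonal fun b => (d b : ℂ)) (h0 : ∀ b, 0 ≤ d b)
    (hd : ∀ b, 2 * d b ≤ ∑ c, d c) :
    ∃ Λ : Matrix (A × B) (A × B) ℂ →
        Matrix ((Fin 2 × Unit) × (Fin 2 × Unit)) ((Fin 2 × Unit) × (Fin 2 × Unit)) ℂ,
      IsLOCC Λ ∧ Λ (pureOfCoeff X) = ((∑ b, d b : ℝ) : ℂ) •
        bipartiteTensor (pureDensity bellState) (1 : Matrix (Unit × Unit) _ ℂ) := by
  obtain ⟨p, p0, ps, pz, pd⟩ := exists_symmetric_weights d h0 hd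
  have hU' : U * Uᴴ = 1 := mul_eq_one_comm.1 hU
  set W := X * U with hW
  -- Since `0⁻¹ = 0`, this is the pseudo-inverse of the Gram matrix of `W`.
  set D : Matrix B B ℂ := diagonal fun b => ((d b : ℂ))⁻¹ with hD
  have hDH : Dᴴ = D := by
    rw [hD, diagonal_conjTranspose]
    congr 1
    ext b
    simp
  have hXW : X = W * Uᴴ := by rw [hW, Matrix.mul_assoc, hU', Matrix.mul_one]
  have hDd : D * (diagonal fun b => (d b : ℂ)) = diagonal fun b => if d b = 0 then 0 else 1 := by
    rw [hD, diagonal_mul_diagonal]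
    congr 1
    ext b
    split_ifs with hb <;> simp [hb]
  -- A column of `W` has squared norm `d b`, so the columns lost by the pseudo-inverse are zero.
  have hWD : W * (D * (diagonal fun b => (d b : ℂ))) = W := by
    rw [hDd]
    ext a b
    rw [mul_diagonal]
    split_ifs with hb
    · have h1 := congrFun (congrFun hX b) b
      rw [diagonal_apply_eq, hb, Complex.ofReal_zero, Matrix.mul_apply] at h1
      rw [eq_zero_of_sum_mul_star_eq_zero (f := fun a => W a b) (by
        rw [← h1]
        exact Finset.sum_congr rfl fun a _ => mul_comm _ _) a, zero_mul]
    · rw [mul_one]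
  -- The projection onto the complement of the range of `W`; it completes Alice's measurement and
  -- annihilates the state.
  set Q : Matrix A A ℂ := 1 - W * D * Wᴴ with hQ
  have hQH : Qᴴ = Q := by
    rw [hQ]
    simp only [conjTranspose_sub, conjTranspose_one, conjTranspose_mul,
      conjTranspose_conjTranspose, hDH, Matrix.mul_assoc]
  have hQW : Q * W = 0 := by
    rw [hQ, Matrix.sub_mul, Matrix.one_mul, Matrix.mul_assoc, hX, Matrix.mul_assoc, hWD, sub_self]
  have hQQ : Qᴴ * Q = 1 - W * D * Wᴴ := by
    rw [hQH]
    nth_rewrite 2 [hQ]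
    rw [Matrix.mul_sub, Matrix.mul_one, Matrix.mul_assoc W D, ← Matrix.mul_assoc Q, hQW,
      Matrix.zero_mul, sub_zero, hQ, Matrix.mul_assoc]
  -- On the range of `W`, `D * Wᴴ` is a left inverse of `W`, so the outcome `(i, j)` leaves
  -- `pairMatrix i j * Uᴴ` with weight `p i j / 2`.
  let M : (B × B) ⊕ A → Matrix (Fin 2 × Unit) A ℂ := Sum.elim
    (fun q => ((√(p q.1 q.2 / 2) : ℝ) : ℂ) • (pairMatrix q.1 q.2 * (D * Wᴴ)))
    (fun a => Matrix.single ((0 : Fin 2), ()) a (1 : ℂ) * Q)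
  have hM : ∑ o, (M o)ᴴ * M o = 1 := by
    rw [Fintype.sum_sum_type]
    have h1 : ∀ q : B × B, (M (Sum.inl q))ᴴ * M (Sum.inl q) = W * D *
        (((p q.1 q.2 / 2 : ℝ) : ℂ) • ((pairMatrix q.1 q.2)ᴴ * pairMatrix q.1 q.2)) * (D * Wᴴ) := by
      intro q
      have h2 : ((√(p q.1 q.2 / 2) : ℝ) : ℂ) * star ((√(p q.1 q.2 / 2) : ℝ) : ℂ)
          = ((p q.1 q.2 / 2 : ℝ) : ℂ) := by
        rw [Complex.star_def, Complex.conj_ofReal, ← Complex.ofReal_mul,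
          Real.mul_self_sqrt (by linarith [p0 q.1 q.2])]
      simp only [M, Sum.elim_inl, conjTranspose_smul, conjTranspose_mul, hDH,
        conjTranspose_conjTranspose, Matrix.smul_mul, Matrix.mul_smul, smul_smul, h2,
        Matrix.mul_assoc]
    have h3 : ∀ a : A, (M (Sum.inr a))ᴴ * M (Sum.inr a) = Qᴴ *
        ((Matrix.single ((0 : Fin 2), ()) a (1 : ℂ))ᴴ * Matrix.single ((0 : Fin 2), ()) a (1 : ℂ)) * Q := by
      intro a
      simp only [M, Sum.elim_inr, conjTranspose_mul, Matrix.mul_assoc]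
    simp only [h1, h3]
    rw [← Matrix.sum_mul, ← Matrix.mul_sum, ← Matrix.sum_mul, ← Matrix.mul_sum,
      sum_smul_pairMatrix ps pz pd, sum_single_conjTranspose_mul, Matrix.mul_one, hQQ,
      Matrix.mul_assoc W D, hWD, Matrix.mul_assoc W D, add_sub_cancel]
  -- Loops and the outcomes of `Q` occur with probability zero, so any protocol of the right type
  -- serves there.
  have hB : ∀ o : (B × B) ⊕ A, ∃ Λ : Matrix ((Fin 2 × Unit) × B) ((Fin 2 × Unit) × B) ℂ →
        Matrix ((Fin 2 × Unit) × (Fin 2 × Unit)) ((Fin 2 × Unit) × (Fin 2 × Unit)) ℂ,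
      IsLOCC Λ ∧ ∀ i j, o = Sum.inl (i, j) → i ≠ j → ∀ c : ℂ,
        Λ (pureOfCoeff (c • (pairMatrix i j * Uᴴ))) = pureOfCoeff (c • 1) := by
    intro o
    by_cases ho : ∃ i j, o = Sum.inl (i, j) ∧ i ≠ j
    · obtain ⟨i, j, rfl, hij⟩ := ho
      obtain ⟨Λ, hΛ, h⟩ := exists_isLOCC_of_pairMatrix hij hU
      refine ⟨Λ, hΛ, fun i' j' h' _ c => ?_⟩
      simp only [Sum.inl.injEq, Prod.mk.injEq] at h'
      obtain ⟨rfl, rfl⟩ := h'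
      exact h c
    · obtain ⟨Λ, hΛ, -⟩ := exists_isLOCC_bob_channel (A := Fin 2 × Unit) _
        (sum_single_conjTranspose_mul (B := B) (0, ()))
      exact ⟨Λ, hΛ, fun i j h1 h2 => absurd ⟨i, j, h1, h2⟩ ho⟩
  choose Λ hΛ hΛ' using hB
  obtain ⟨Λ', h1, h2⟩ := exists_isLOCC_alice_measurement M hM Λ hΛ
  refine ⟨Λ', h1, ?_⟩
  have hinl : ∀ q : B × B, Λ (Sum.inl q) (pureOfCoeff (M (Sum.inl q) * X))
      = (p q.1 q.2 : ℂ) • bipartiteTensor (pureDensity bellState) (1 : Matrix (Unit × Unit) _ ℂ) := by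
    rintro ⟨i, j⟩
    rcases eq_or_lt_of_le (p0 i j) with hp | hp
    · simp [M, ← hp, (hΛ _).map_zero]
    · have hij : i ≠ j := by
        rintro rfl
        exact hp.ne' (pz i)
      have hi : d i ≠ 0 := by
        have := Finset.single_le_sum (fun k _ => p0 i k) (Finset.mem_univ j)
        rw [pd] at this
        exact (hp.trans_le this).ne'
      have hj : d j ≠ 0 := by
        have := Finset.single_le_sum (fun k _ => p0 j k) (Finset.mem_univ i)
        rw [pd, ← ps] at this
        exact (hp.trans_le this).ne'
      have hMX : M (Sum.inl (i, j)) * X = ((√(p i j / 2) : ℝ) : ℂ) • (pairMatrix i j * Uᴴ) := by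
        simp only [M, Sum.elim_inl, Matrix.smul_mul]
        congr 1
        rw [hXW, ← Matrix.mul_assoc _ W, Matrix.mul_assoc _ _ W, Matrix.mul_assoc D, hX, hDd,
          pairMatrix_mul_diagonal (by simp [hi]) (by simp [hj])]
      -- The unnormalized vector `|00⟩ + |11⟩` has squared norm 2, which turns `p i j / 2` into `p i
      -- j`.
      rw [hMX, hΛ' _ i j rfl hij, pureOfCoeff_real_smul, pureOfCoeff_one, smul_smul,
        Real.sq_sqrt (by linarith)]
      congr 1
      push_cast
      ring
  have hinr : ∀ a : A, Λ (Sum.inr a) (pureOfCoeff (M (Sum.inr a) * X)) = 0 := by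
    intro a
    have : M (Sum.inr a) * X = 0 := by
      simp only [M, Sum.elim_inr]
      rw [hXW, Matrix.mul_assoc _ Q, ← Matrix.mul_assoc Q, hQW, Matrix.zero_mul, Matrix.mul_zero]
    rw [this, pureOfCoeff_zero, (hΛ _).map_zero]
  rw [h2, Fintype.sum_sum_type]
  simp only [hinl, hinr, Finset.sum_const_zero, add_zero]
  rw [← Finset.sum_smul, Fintype.sum_prod_type]
  congr 1
  push_cast
  refine Finset.sum_congr rfl fun i _ => ?_
  rw [← pd i]
  push_cast
  rfl

/-- **Nielsen's criterion** for the Bell pair: a unit vector whose largest squared Schmidt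
coefficient is at most one half is converted to a Bell pair by LOCC. -/
theorem canRestoreBellPair_of_maxSqSchmidt_le {A B : Type} [Fintype A] [Fintype B] [DecidableEq B]
    {Ψ : EuclideanSpace ℂ (A × B)} (hΨ : ‖Ψ‖ = 1) (h : maxSqSchmidt Ψ ≤ 1 / 2) :
    CanRestoreBellPair Ψ := by
  classical
  set X := coeffMatrix Ψ with hXdef
  have hH := isHermitian_conjTranspose_mul_self X
  set U : Matrix B B ℂ := (hH.eigenvectorUnitary : Matrix B B ℂ) with hUdef
  have hU : Uᴴ * U = 1 := Unitary.coe_star_mul_self hH.eigenvectorUnitary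
  have hX : (X * U)ᴴ * (X * U) = diagonal fun b => (hH.eigenvalues b : ℂ) := by
    have h1 := hH.conjStarAlgAut_star_eigenvectorUnitary
    rw [Unitary.conjStarAlgAut_star_apply] at h1
    rw [conjTranspose_mul, Matrix.mul_assoc, ← Matrix.mul_assoc Xᴴ, ← Matrix.mul_assoc]
    exact h1
  have hsum : ∑ b, hH.eigenvalues b = 1 := by
    have h1 := hH.trace_eq_sum_eigenvalues
    have h2 : (Xᴴ * X).trace = 1 := by
      have h3 : ∑ p, ‖Ψ p‖ ^ 2 = 1 := by
        rw [← EuclideanSpace.norm_sq_eq, hΨ, one_pow]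
      rw [Matrix.trace_mul_comm]
      have h4 : (X * Xᴴ).trace = ((∑ p, ‖Ψ p‖ ^ 2 : ℝ) : ℂ) := by
        rw [Fintype.sum_prod_type]
        simp [Matrix.trace, Matrix.mul_apply, hXdef, coeffMatrix, Complex.mul_conj']
      rw [h4, h3, Complex.ofReal_one]
    rw [h2] at h1
    apply Complex.ofReal_injective
    push_cast
    exact h1.symm
  obtain ⟨Λ, h1, h2⟩ := exists_isLOCC_to_bell X hU hX
    (fun b => (posSemidef_conjTranspose_mul_self X).eigenvalues_nonneg b) (fun b => by
      rw [hsum]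
      have := eigenvalues_le_maxSqSchmidt Ψ b
      linarith)
  refine ⟨Unit, Unit, inferInstance, inferInstance, Λ, 1, h1, ⟨PosSemidef.one, by simp⟩, ?_⟩
  rw [pureDensity_eq_pureOfCoeff, h2, hsum, Complex.ofReal_one, one_smul]

/-! ### The transfer state -/

theorem norm_transferState {A' B' K : Type} [Fintype A'] [Fintype B'] [Fintype K] (θ : ℝ)
    (Ω : EuclideanSpace ℂ (A' × B' × K)) : ‖transferState θ Ω‖ = ‖Ω‖ := by
  have h : ∑ p, ‖transferState θ Ω p‖ ^ 2
      = (‖(Real.cos θ : ℂ)‖ ^ 2 + ‖(Real.sin θ : ℂ)‖ ^ 2) * ∑ q, ‖Ω q‖ ^ 2 := by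
    simp only [transferState, linkState, Fintype.sum_prod_type, Fin.sum_univ_two, norm_mul,
      mul_pow, Prod.mk.injEq]
    simp only [one_ne_zero, zero_ne_one, and_true, and_false, if_true, if_false,
      norm_zero, and_self, ne_eq, OfNat.ofNat_ne_zero, not_false_eq_true, zero_pow, zero_mul,
      Finset.sum_const_zero, add_zero, zero_add, ← Finset.mul_sum]
    rw [add_mul]
    congr 2 <;> exact Finset.sum_congr rfl fun a _ => Finset.sum_comm
  rw [EuclideanSpace.norm_eq, h, EuclideanSpace.norm_eq]
  simp only [Complex.norm_real, Real.norm_eq_abs, sq_abs, Real.cos_sq_add_sin_sq, one_mul]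

theorem mainTheorem5 {A' B' K : Type} [Fintype A'] [Fintype B'] [Fintype K] [DecidableEq B']
    (θ : ℝ) (hθ : θ ∈ Set.Ioo 0 (Real.pi / 2))
    (Ω : EuclideanSpace ℂ (A' × B' × K)) (hΩ : ‖Ω‖ = 1) :
    CanRestoreBellPair (transferState θ Ω) ↔ maxSqSchmidt (transferState θ Ω) ≤ 1 / 2 :=
  ⟨CanRestoreBellPair.maxSqSchmidt_le,
    canRestoreBellPair_of_maxSqSchmidt_le ((norm_transferState θ Ω).trans hΩ)⟩
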